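/- Let $L\ge 2$ and $\nu\ge 2$ be integers and let $\tau\ge \frac{\log 5}{\log\nu}$ be real. Over the alphabet $\mathcal A=\{0,1,\dots,L\nu\}$ let $C_j=\{(j-1)\nu+1,\dots,j\nu\}$ be the set of symbols of colour $j$ ($j=1,\dots,L$), and let $\Sigma\subset\mathcal A^{\mathbb Z}$ be the set of all sequences $x$ such that (a) any two neighbouring nonzero symbols of $x$ have the same colour; (b) whenever two maximal blocks $\alpha,\beta$ of nonzero symbols of $x$ are separated by a finite string of $\lambda\ge1$ zeros, both $\alpha$ and $\beta$ are finite, their colours $j,j'$ satisfy $|j-j'|=1$, and $\lambda\ge\tau(|\alpha|+|\beta|)$. In particular $\Sigma$ contains the $L$ full $\nu$-shifts $\Sigma_j=C_j^{\mathbb Z}$, and an infinite coloured block can only be followed or preceded by an infinite string of zeros. The set $\Sigma$ is closed and invariant under the shift $\sigma(x)_i=x_{i+1}$; consider the system $\sigma:\Sigma\to\Sigma$ with the product topology. Then $h_{\rm top}(\Sigma,\sigma)=\log\nu$. Moreover, for $j=1,\dots,L$ let $\mu_j$ be the Bernoulli measure on $\Sigma$ giving weight $\frac1\nu$ to each symbol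 of $C_j$ and weight $0$ to all other symbols. Then each $\mu_j$ is an ergodic $\sigma$-invariant probability measure of maximal entropy, i.e. its metric entropy satisfies $h_{\mu_j}(\sigma)=h_{\rm top}(\Sigma,\sigma)$, and $\mu_1,\dots,\mu_L$ are pairwise distinct and mutually singular. -/

import Mathlib

open MeasureTheory ProbabilityTheory Filter Set
open SymbolicDynamics.FullShift (shift Subshift)

noncomputable section

/-! ### Entropy of a general system -/

section Entropy

variable {X : Type*}

/-- The topological entropy of `T : X → X`. -/
def topEntropy [UniformSpace X] (T : X → X) : EReal :=
  Dynamics.coverEntropy T univ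

variable [MeasurableSpace X]

/-- The Shannon entropy `H_μ(ξ ∨ T⁻¹ξ ∨ ⋯ ∨ T⁻⁽ⁿ⁻¹⁾ξ)` of the `n`-fold refinement of the finite
partition `{ξ⁻¹(0), …, ξ⁻¹(k-1)}`: the cells of the refinement are indexed by the words `w` of
length `n` over `{0, …, k-1}`. -/
def refinedEntropy (T : X → X) (μ : Measure X) {k : ℕ} (ξ : X → Fin k) (n : ℕ) : ℝ :=
  ∑ w : Fin n → Fin k, Real.negMulLog (μ.real {x | ∀ i : Fin n, ξ (T^[i] x) = w i})

/-- The entropy `h_μ(T, ξ) = lim (1/n) H_μ(ξ ∨ T⁻¹ξ ∨ ⋯ ∨ T⁻⁽ⁿ⁻¹⁾ξ)` of `T` relative to a finite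
partition. The limit exists for invariant `μ`; it is written as an upper limit. -/
def partitionEntropy (T : X → X) (μ : Measure X) {k : ℕ} (ξ : X → Fin k) : EReal :=
  limsup (fun n : ℕ => ((refinedEntropy T μ ξ n / n : ℝ) : EReal)) atTop

/-- The metric (Kolmogorov–Sinai) entropy `h_μ(T)`: the supremum of `h_μ(T, ξ)` over all finite
measurable partitions `ξ`. -/
def metricEntropy (T : X → X) (μ : Measure X) : EReal :=
  ⨆ (k : ℕ) (ξ : X → Fin k) (_ : Measurable ξ), partitionEntropy T μ ξ

/-- A measure of maximal entropy: an invariant probability measure whose metric entropy is the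
topological entropy. -/
structure IsMeasureOfMaximalEntropy [UniformSpace X] (T : X → X) (μ : Measure X) : Prop where
  isProbabilityMeasure : IsProbabilityMeasure μ
  measurePreserving : MeasurePreserving T μ μ
  metricEntropy_eq : metricEntropy T μ = topEntropy T

end Entropy

/-! ### The subshift -/

/-- The alphabet `{0, 1, …, Lν}`, with its discrete structures. -/
abbrev Letter (L ν : ℕ) : Type := Fin (L * ν + 1)

/-- The discrete uniformity on the alphabet; sequences then carry the product uniformity. -/
instance Letter.instUniformSpace (L ν : ℕ) : UniformSpace (Letter L ν) := ⊥

/-- The `ν` symbols `jν + 1, …, (j + 1)ν` of colour `j`, the colours being numbered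
`0, …, L - 1`. The symbol `0` has no colour. -/
def colour {L : ℕ} (ν : ℕ) (j : Fin L) : Set (Letter L ν) :=
  {s | (j : ℕ) * ν + 1 ≤ (s : ℕ) ∧ (s : ℕ) ≤ ((j : ℕ) + 1) * ν}

/-- The set of sequences of the subshift. Neighbouring nonzero symbols have the same colour.
Whenever words `α`, `β` of lengths `a, b ≥ 1` without zeros are separated by a string of `l ≥ 1`
zeros, `α` has one colour, `β` has one colour, the two colours are adjacent, and
`l ≥ τ (a + b)`. Since `α` and `β` range over all zero-free words next to the string of zeros, the
bound holds for the longest such words, and for `τ > 0` an infinite coloured word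
can only be followed or preceded by infinitely many zeros. -/
def colouredSequences (L ν : ℕ) (τ : ℝ) : Set (ℤ → Letter L ν) :=
  {x | (∀ n : ℤ, x n ≠ 0 → x (n + 1) ≠ 0 →
          ∃ j : Fin L, x n ∈ colour ν j ∧ x (n + 1) ∈ colour ν j) ∧
       (∀ (n : ℤ) (a l b : ℕ), 1 ≤ a → 1 ≤ l → 1 ≤ b →
          (∀ i < a, x (n + i) ≠ 0) →
          (∀ i < l, x (n + a + i) = 0) →
          (∀ i < b, x (n + a + l + i) ≠ 0) →
          τ * (a + b) ≤ l ∧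
          ∃ j j' : Fin L, ((j' : ℕ) = j + 1 ∨ (j : ℕ) = j' + 1) ∧
            (∀ i < a, x (n + i) ∈ colour ν j) ∧
            (∀ i < b, x (n + a + l + i) ∈ colour ν j'))}

lemma isClopen_coord {A : Type*} [TopologicalSpace A] [DiscreteTopology A] (S : Set A) (n : ℤ) :
    IsClopen {x : ℤ → A | x n ∈ S} :=
  (isClopen_discrete S).preimage (continuous_apply n)

lemma isClopen_coords {A : Type*} [TopologicalSpace A] [DiscreteTopology A] (S : Set A)
    (a : ℕ) (f : ℕ → ℤ) : IsClopen {x : ℤ → A | ∀ i < a, x (f i) ∈ S} := by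
  have h : {x : ℤ → A | ∀ i < a, x (f i) ∈ S} =
      ⋂ i ∈ Finset.range a, {x : ℤ → A | x (f i) ∈ S} := by
    ext x; simp
  rw [h]
  exact isClopen_biInter_finset fun i _ => isClopen_coord S (f i)

lemma isClosed_colouredSequences (L ν : ℕ) (τ : ℝ) : IsClosed (colouredSequences L ν τ) := by
  refine IsClosed.and ?_ ?_
  · simp only [ofPred_forall]
    refine isClosed_iInter fun n => ?_
    refine isClosed_imp (isClopen_coord {0}ᶜ n).isOpen ?_
    refine isClosed_imp (isClopen_coord {0}ᶜ (n + 1)).isOpen ?_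
    simp only [ofPred_exists]
    exact isClosed_iUnion_of_finite fun j =>
      (isClopen_coord _ n).isClosed.and (isClopen_coord _ (n + 1)).isClosed
  · simp only [ofPred_forall (ι := ℤ), ofPred_forall (ι := ℕ)]
    refine isClosed_iInter fun n => isClosed_iInter fun a => isClosed_iInter fun l =>
      isClosed_iInter fun b => ?_
    refine isClosed_imp isOpen_const (isClosed_imp isOpen_const (isClosed_imp isOpen_const ?_))
    refine isClosed_imp (isClopen_coords {0}ᶜ a fun i => n + i).isOpen ?_
    refine isClosed_imp (isClopen_coords {0} l fun i => n + a + i).isOpen ?_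
    refine isClosed_imp (isClopen_coords {0}ᶜ b fun i => n + a + l + i).isOpen ?_
    refine isClosed_const.and ?_
    simp only [ofPred_exists]
    exact isClosed_iUnion_of_finite fun j => isClosed_iUnion_of_finite fun j' =>
      isClosed_const.and ((isClopen_coords _ a fun i => n + i).isClosed.and
        (isClopen_coords _ b fun i => n + a + l + i).isClosed)

lemma mapsTo_shift_colouredSequences (L ν : ℕ) (τ : ℝ) (g : ℤ) :
    MapsTo (shift g) (colouredSequences L ν τ) (colouredSequences L ν τ) := by
  intro x hx
  refine ⟨fun n h h' => ?_, fun n a l b ha hl hb h₁ h₂ h₃ => ?_⟩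
  · have := hx.1 (g + n)
    simp only [SymbolicDynamics.FullShift.shift_apply, add_assoc] at *
    exact this h h'
  · have := hx.2 (g + n) a l b ha hl hb
    simp only [SymbolicDynamics.FullShift.shift_apply, add_assoc] at *
    exact this h₁ h₂ h₃

/-- The subshift `Σ ⊆ {0, …, Lν}^ℤ`: a closed set of sequences, invariant under all shifts. -/
def colouredSubshift (L ν : ℕ) (τ : ℝ) : Subshift (Letter L ν) ℤ where
  carrier := colouredSequences L ν τ
  isClosed := isClosed_colouredSequences L ν τ
  mapsTo := mapsTo_shift_colouredSequences L ν τ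

/-- The shift transformation `(σ x)ᵢ = xᵢ₊₁` on `Σ`. -/
def shiftMap (L ν : ℕ) (τ : ℝ) :
    (colouredSubshift L ν τ).carrier → (colouredSubshift L ν τ).carrier :=
  ((colouredSubshift L ν τ).mapsTo 1).restrict

/-- The Bernoulli measure on `{0, …, Lν}^ℤ` with weight `1/ν` on each of the `ν` symbols of
colour `j` and weight `0` on all other symbols. -/
def fullBernoulli {L : ℕ} (ν : ℕ) (j : Fin L) : Measure (ℤ → Letter L ν) :=
  Measure.infinitePi fun _ : ℤ => uniformOn (colour ν j)

/-- The same Bernoulli measure, as a measure on `Σ`. -/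
def colourBernoulli {L : ℕ} (ν : ℕ) (τ : ℝ) (j : Fin L) : Measure (colouredSubshift L ν τ).carrier :=
  (fullBernoulli ν j).comap Subtype.val

end

/-!
Topological entropy. A full `ν`-shift sits inside the subshift, so `log ν` is a lower bound. For the
upper bound the words of length `n` are counted: there are at most `6 L νⁿ` of them
(`exists_finset_words`). A word that begins with colour `j` consists of a coloured block of length
`a` (`νᵃ` choices), then zeros up to its end, or `l ≥ τ (a + 1)` zeros followed by a shorter word
that begins with one of at most two adjacent colours. Because `ν ^ τ ≥ 5`, the strings of zeros cost
so much that, in units of `νⁿ`, the second kind contributes at most `1/5` of the bound for shorter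
words, and the induction closes with the constant `5/2` (`exists_finset_words_of_colour`).
Entourages of the subshift contain the relation of agreeing on a finite window, so words give
dynamical covers (`topEntropy_shiftMap_le`).

Metric entropy. For every invariant probability measure on the full shift `A^ℤ` the entropy is at
most the Shannon entropy of one coordinate (`metricEntropy_shift_le`). A finite partition `ξ` is
close in measure to a partition `η` that depends on finitely many coordinates; the correction
`ξ - η`, with values in `Fin k`, is almost constant and so has small entropy, and subadditivity of
Shannon entropy bounds the refinements of `ξ` by those of `η` and of the correction. For a Bernoulli measure the
coordinate partition attains the bound (`metricEntropy_shift_infinitePi`). Ergodicity follows by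
approximating an invariant set by a cylinder, which is independent of a far shift of itself.

The Bernoulli measure of a colour is carried by the sequences of that colour, which lie in the
subshift. The inclusion of the subshift and an equivariant retraction onto it transport invariance,
ergodicity and entropy between the full shift and the subshift. The symbol at `0` separates the
measures of different colours.
-/

/-! ### Shannon entropy of maps with finitely many values -/

section Shannon

variable {Ω α β : Type*} [MeasurableSpace Ω] {μ : Measure Ω}
  [Fintype α] [MeasurableSpace α] [MeasurableSingletonClass α]
  [Fintype β] [MeasurableSpace β] [MeasurableSingletonClass β]

/-- The Shannon entropy `H(X)` of the distribution of a map `X` with values in a finite type. -/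
noncomputable def shannonEntropy {α : Type*} [Fintype α] (μ : Measure Ω) (X : Ω → α) : ℝ :=
  ∑ a, Real.negMulLog (μ.real (X ⁻¹' {a}))

lemma refinedEntropy_eq_shannonEntropy (T : Ω → Ω) {k : ℕ} (ξ : Ω → Fin k) (n : ℕ) :
    refinedEntropy T μ ξ n = shannonEntropy μ fun x (i : Fin n) => ξ (T^[i] x) := by
  refine Finset.sum_congr rfl fun w _ => ?_
  congr 2
  ext x
  simp [funext_iff]

lemma shannonEntropy_comp_measurePreserving {Ω' : Type*} [MeasurableSpace Ω'] {μ' : Measure Ω'}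
    {f : Ω → Ω'} (hf : MeasurePreserving f μ μ') {X : Ω' → α} (hX : Measurable X) :
    shannonEntropy μ (X ∘ f) = shannonEntropy μ' X := by
  refine Finset.sum_congr rfl fun a _ => ?_
  rw [preimage_comp, hf.measureReal_preimage (hX (measurableSet_singleton a)).nullMeasurableSet]

lemma measureReal_preimage_eq_sum [IsFiniteMeasure μ] {X : Ω → α} (hX : Measurable X) (s : Set Ω)
    (hs : MeasurableSet s) :
    μ.real s = ∑ a, μ.real (X ⁻¹' {a} ∩ s) := by
  rw [← measureReal_biUnion_finset]
  · congr 1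
    ext x
    simp
  · intro a _ b _ hab
    refine Disjoint.mono inter_subset_left inter_subset_left ?_
    exact Disjoint.preimage _ (by simpa using hab)
  · exact fun a _ => (hX (measurableSet_singleton a)).inter hs

lemma negMulLog_sum_le {ι : Type*} (s : Finset ι) (p : ι → ℝ) (hp : ∀ i ∈ s, 0 ≤ p i) :
    Real.negMulLog (∑ i ∈ s, p i) ≤ ∑ i ∈ s, Real.negMulLog (p i) := by
  simp only [Real.negMulLog, neg_mul, Finset.sum_neg_distrib, Finset.sum_mul, neg_le_neg_iff]
  refine Finset.sum_le_sum fun i hi => ?_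
  rcases (hp i hi).eq_or_lt with h | h
  · simp [← h]
  · exact mul_le_mul_of_nonneg_left
      (Real.log_le_log h (Finset.single_le_sum hp hi)) h.le

/-- A function of `X` carries at most as much entropy as `X`. -/
lemma shannonEntropy_comp_le {γ : Type*} [Fintype γ] [IsFiniteMeasure μ] {X : Ω → α}
    (hX : Measurable X) (f : α → γ) :
    shannonEntropy μ (f ∘ X) ≤ shannonEntropy μ X := by
  classical
  unfold shannonEntropy
  rw [← Finset.sum_fiberwise (s := Finset.univ) (g := f)]
  refine Finset.sum_le_sum fun b _ => ?_
  have h : μ.real (f ∘ X ⁻¹' {b}) = ∑ a with f a = b, μ.real (X ⁻¹' {a}) := by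
    rw [← measureReal_biUnion_finset]
    · congr 1
      ext x
      simp
    · intro a _ c _ hac
      exact Disjoint.preimage _ (by simpa using hac)
    · exact fun a _ => hX (measurableSet_singleton a)
  rw [h]
  exact negMulLog_sum_le _ _ fun _ _ => measureReal_nonneg

/-- Gibbs' inequality in one variable: summed over two distributions `p`, `q`, the last term
vanishes. -/
lemma negMulLog_le_mul_log_add {p q : ℝ} (hp : 0 ≤ p) (hq : 0 ≤ q) (h : q = 0 → p = 0) :
    Real.negMulLog p ≤ -(p * Real.log q) + (q - p) := by
  rcases hp.eq_or_lt with rfl | hp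
  · simpa using hq
  have hq' : 0 < q := lt_of_le_of_ne hq fun h' => hp.ne' (h h'.symm)
  have := Real.log_le_sub_one_of_pos (div_pos hq' hp)
  rw [Real.log_div hq'.ne' hp.ne'] at this
  have h2 := mul_le_mul_of_nonneg_left this hp.le
  have h3 : p * (q / p - 1) = q - p := by field_simp
  rw [h3] at h2
  unfold Real.negMulLog
  linarith

/-- Subadditivity of entropy. -/
lemma shannonEntropy_prodMk_le [IsProbabilityMeasure μ] {X : Ω → α} {Y : Ω → β}
    (hX : Measurable X) (hY : Measurable Y) :
    shannonEntropy μ (fun x => (X x, Y x)) ≤ shannonEntropy μ X + shannonEntropy μ Y := by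
  set p : α → ℝ := fun a => μ.real (X ⁻¹' {a}) with hp
  set q : β → ℝ := fun b => μ.real (Y ⁻¹' {b}) with hq
  set r : α → β → ℝ := fun a b => μ.real (X ⁻¹' {a} ∩ Y ⁻¹' {b}) with hr
  have mX (a : α) : MeasurableSet (X ⁻¹' {a}) := hX (measurableSet_singleton a)
  have mY (b : β) : MeasurableSet (Y ⁻¹' {b}) := hY (measurableSet_singleton b)
  have hpr (a : α) : p a = ∑ b, r a b := by
    simp only [hp, hr]
    rw [measureReal_preimage_eq_sum hY _ (mX a)]
    simp_rw [inter_comm]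
  have hqr (b : β) : q b = ∑ a, r a b := measureReal_preimage_eq_sum hX _ (mY b)
  have hp1 : ∑ a, p a = 1 := by
    have := measureReal_preimage_eq_sum (μ := μ) hX univ .univ
    simpa using this.symm
  have hq1 : ∑ b, q b = 1 := by
    have := measureReal_preimage_eq_sum (μ := μ) hY univ .univ
    simpa using this.symm
  have hr0 (a : α) (b : β) : 0 ≤ r a b := measureReal_nonneg
  have key (a : α) (b : β) : Real.negMulLog (r a b) ≤
      -(r a b * Real.log (p a)) - r a b * Real.log (q b) + (p a * q b - r a b) := by
    have hpa : r a b ≤ p a := measureReal_mono inter_subset_left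
    have hqb : r a b ≤ q b := measureReal_mono inter_subset_right
    have hp0 : 0 ≤ p a := measureReal_nonneg
    have hq0 : 0 ≤ q b := measureReal_nonneg
    rcases (hr0 a b).eq_or_lt with h | h
    · rw [← h]; simpa using mul_nonneg hp0 hq0
    · have := negMulLog_le_mul_log_add h.le (mul_nonneg hp0 hq0) fun h' => by
        rcases mul_eq_zero.1 h' with h' | h' <;> linarith
      rw [Real.log_mul (by linarith) (by linarith)] at this
      linarith
  have hsum : shannonEntropy μ (fun x => (X x, Y x)) = ∑ a, ∑ b, Real.negMulLog (r a b) := by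
    unfold shannonEntropy
    rw [Fintype.sum_prod_type]
    refine Finset.sum_congr rfl fun a _ => Finset.sum_congr rfl fun b _ => ?_
    congr 2
    ext x
    simp
  rw [hsum]
  calc ∑ a, ∑ b, Real.negMulLog (r a b)
      ≤ ∑ a, ∑ b, (-(r a b * Real.log (p a)) - r a b * Real.log (q b) +
          (p a * q b - r a b)) :=
        Finset.sum_le_sum fun a _ => Finset.sum_le_sum fun b _ => key a b
    _ = -(∑ a, ∑ b, r a b * Real.log (p a)) - (∑ a, ∑ b, r a b * Real.log (q b)) +
          ((∑ a, ∑ b, p a * q b) - ∑ a, ∑ b, r a b) := by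
        simp only [Finset.sum_add_distrib, Finset.sum_sub_distrib, Finset.sum_neg_distrib]
    _ = shannonEntropy μ X + shannonEntropy μ Y := by
        rw [Finset.sum_comm (f := fun a b => r a b * Real.log (q b))]
        simp only [← Finset.sum_mul, ← Finset.mul_sum, ← hpr, ← hqr, hp1, hq1]
        simp [shannonEntropy, Real.negMulLog, hp, hq, Finset.sum_neg_distrib, sub_eq_add_neg]

lemma shannonEntropy_pi_le [IsProbabilityMeasure μ] {n : ℕ} {X : Fin n → Ω → α}
    (hX : ∀ i, Measurable (X i)) :
    shannonEntropy μ (fun x i => X i x) ≤ ∑ i, shannonEntropy μ (X i) := by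
  induction n with
  | zero =>
    simp only [shannonEntropy, Finset.univ_eq_empty, Finset.sum_empty]
    refine (Finset.sum_eq_zero fun w _ => ?_).le
    have : (fun (x : Ω) (i : Fin 0) => X i x) ⁻¹' {w} = univ := by
      ext x; simpa using Subsingleton.elim _ _
    simp [this]
  | succ n ih =>
    rw [Fin.sum_univ_succ]
    have hY : Measurable fun x (i : Fin n) => X i.succ x :=
      measurable_pi_lambda _ fun i => hX i.succ
    have h := shannonEntropy_comp_le (μ := μ) ((hX 0).prodMk hY)
      (fun y => (Fin.cons y.1 y.2 : Fin (n + 1) → α))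
    have h2 : ((fun y => (Fin.cons y.1 y.2 : Fin (n + 1) → α)) ∘
        fun x => (X 0 x, fun i : Fin n => X i.succ x)) = fun x i => X i x := by
      ext x i
      refine Fin.cases ?_ (fun i => ?_) i <;> simp
    rw [h2] at h
    have h3 := shannonEntropy_prodMk_le (μ := μ) (hX 0) hY
    have h4 := ih fun i => hX i.succ
    linarith

/-- A map that is nearly constant has small entropy. -/
lemma exists_shannonEntropy_lt (α : Type*) [Fintype α] [MeasurableSpace α]
    [MeasurableSingletonClass α] (a₀ : α) {δ : ℝ} (hδ : 0 < δ) :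
    ∃ ε > 0, ∀ {Ω : Type*} [MeasurableSpace Ω] (μ : Measure Ω) [IsProbabilityMeasure μ] (X : Ω → α),
      Measurable X → μ.real {x | X x ≠ a₀} < ε → shannonEntropy μ X < δ := by
  classical
  -- the entropy is a continuous function of the vector of probabilities
  have hc : Continuous fun p : α → ℝ => ∑ a, Real.negMulLog (p a) := by fun_prop
  have h0 : ∑ a, Real.negMulLog ((Pi.single a₀ 1 : α → ℝ) a) = 0 := by
    refine Finset.sum_eq_zero fun a _ => ?_
    by_cases h : a = a₀ <;> simp [h]
  obtain ⟨ε, hε, h⟩ := Metric.continuous_iff.1 hc (Pi.single a₀ 1) δ hδ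
  refine ⟨ε, hε, fun {Ω} _ μ _ X hX hXε => ?_⟩
  have := h (fun a => μ.real (X ⁻¹' {a})) ?_
  · simp only [Real.dist_eq, h0, sub_zero] at this
    exact (le_abs_self _).trans_lt this
  · rw [dist_pi_lt_iff hε]
    intro a
    refine lt_of_le_of_lt ?_ hXε
    by_cases ha : a = a₀
    · subst ha
      have hcompl : μ.real {x | X x ≠ a} = 1 - μ.real (X ⁻¹' {a}) := by
        rw [← probReal_compl_eq_one_sub (hX (measurableSet_singleton a))]
        rfl
      rw [hcompl, Real.dist_eq, Pi.single_eq_same, abs_sub_comm, abs_of_nonneg]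
      exact sub_nonneg.2 measureReal_le_one
    · rw [Pi.single_eq_of_ne ha, Real.dist_eq, sub_zero, abs_of_nonneg measureReal_nonneg]
      refine measureReal_mono fun x hx => ?_
      simp only [mem_preimage, mem_singleton_iff] at hx
      simpa [hx] using ha

end Shannon

/-! ### Metric entropy of factors and of the full shift -/

section MetricEntropy

open scoped Topology

/-- Metric entropy does not increase under factor maps. -/
lemma metricEntropy_le_of_semiconj {X Y : Type*} [MeasurableSpace X] [MeasurableSpace Y]
    {μ : Measure X} {μ' : Measure Y} {f : X → Y} {T : X → X} {S : Y → Y}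
    (hf : MeasurePreserving f μ μ') (hS : Measurable S) (h : Function.Semiconj f T S) :
    metricEntropy S μ' ≤ metricEntropy T μ := by
  refine iSup_le fun k => iSup_le fun ξ => iSup_le fun hξ => ?_
  refine le_trans (le_of_eq ?_) (le_iSup_of_le k <| le_iSup_of_le (ξ ∘ f) <|
    le_iSup_of_le (hξ.comp hf.measurable) le_rfl)
  unfold partitionEntropy
  congr! 3 with n
  rw [refinedEntropy_eq_shannonEntropy, refinedEntropy_eq_shannonEntropy]
  congr 1
  rw [← shannonEntropy_comp_measurePreserving hf
    (measurable_pi_lambda (fun y (i : Fin n) => ξ (S^[i] y)) fun i => hξ.comp (hS.iterate i))]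
  congr 1
  ext x i
  simp [(h.iterate_right i).eq]

variable {A : Type*}

lemma iterate_shift_one (n : ℕ) (x : ℤ → A) (c : ℤ) : (shift (1 : ℤ))^[n] x c = x (n + c) := by
  induction n generalizing x with
  | zero => simp
  | succ n ih =>
    rw [Function.iterate_succ_apply, ih, SymbolicDynamics.FullShift.shift_apply]
    congr 1
    push_cast
    ring

variable [MeasurableSpace A]

lemma measurable_shift (g : ℤ) : Measurable (shift g : (ℤ → A) → ℤ → A) :=
  measurable_pi_lambda _ fun h => measurable_pi_apply (g + h)

lemma exists_window_of_mem_measurableCylinders {D : Set (ℤ → A)}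
    (hD : D ∈ measurableCylinders fun _ : ℤ => A) :
    ∃ m : ℕ, ∀ x y : ℤ → A, (∀ c : ℤ, |c| ≤ m → x c = y c) → (x ∈ D ↔ y ∈ D) := by
  obtain ⟨s, S, -, rfl⟩ := (mem_measurableCylinders D).1 hD
  refine ⟨s.sup Int.natAbs, fun x y h => ?_⟩
  have : s.restrict x = s.restrict y := by
    ext ⟨c, hc⟩
    refine h c ?_
    have := Finset.le_sup (f := Int.natAbs) hc
    rw [Int.abs_eq_natAbs]
    exact_mod_cast this
  simp [mem_cylinder, this]

/-- Every finite measurable partition of `ℤ → A` is approximated by one that depends on finitely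
many coordinates. -/
lemma exists_window_approx (P : Measure (ℤ → A))
    [IsProbabilityMeasure P] {k : ℕ} {ξ : (ℤ → A) → Fin k} (hξ : Measurable ξ)
    {ε : ℝ} (hε : 0 < ε) :
    ∃ (m : ℕ) (F : (Fin (2 * m + 1) → A) → Fin k),
      P.real {x | ξ x ≠ F fun t => x (t - m)} < ε := by
  classical
  have : NeZero k := by
    constructor
    rintro rfl
    obtain ⟨x⟩ : Nonempty (ℤ → A) := P.nonempty_of_neZero
    exact (ξ x).elim0
  have : Nonempty A := by
    obtain ⟨x⟩ : Nonempty (ℤ → A) := P.nonempty_of_neZero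
    exact ⟨x 0⟩
  have hdense : P.MeasureDense (measurableCylinders fun _ : ℤ => A) :=
    Measure.MeasureDense.of_generateFrom_isSetAlgebra_finite P isSetAlgebra_measurableCylinders
      generateFrom_measurableCylinders.symm
  have hk : (0 : ℝ) < k := by exact_mod_cast Nat.pos_of_ne_zero (NeZero.ne k)
  choose D hD hDε using fun i : Fin k => hdense.approx (ξ ⁻¹' {i})
    (hξ (measurableSet_singleton i)) (measure_ne_top _ _) (ε / k) (by positivity)
  choose m hm using fun i => exists_window_of_mem_measurableCylinders (hD i)
  set M := Finset.univ.sup m with hM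
  -- the approximating partition only depends on which of the sets `D i` contain the point
  let G : Set (Fin k) → Fin k := fun s => if h : s.Nonempty then h.some else 0
  let η : (ℤ → A) → Fin k := fun x => G {i | x ∈ D i}
  have hη : η.FactorsThrough fun (x : ℤ → A) (t : Fin (2 * M + 1)) => x (t - M) := by
    intro x y hxy
    have : {i | x ∈ D i} = {i | y ∈ D i} := by
      ext i
      refine hm i x y fun c hc => ?_
      have hc' : |c| ≤ M := hc.trans (by exact_mod_cast Finset.le_sup (f := m) (Finset.mem_univ i))
      rw [abs_le] at hc'
      have := congrFun hxy ⟨(c + M).toNat, by omega⟩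
      simp only at this
      rwa [show (((c + M).toNat : ℕ) : ℤ) - M = c by omega] at this
    simp only [η, this]
  obtain ⟨F, hF⟩ := (Function.factorsThrough_iff η).1 hη
  refine ⟨M, F, ?_⟩
  have hsub : {x | ξ x ≠ F fun t : Fin (2 * M + 1) => x (t - M)} ⊆
      ⋃ i ∈ (Finset.univ : Finset (Fin k)), symmDiff (ξ ⁻¹' {i}) (D i) := by
    intro x hx
    have hx' : ξ x ≠ η x := by rw [hF]; exact hx
    by_contra hcon
    apply hx'
    have hiff (i : Fin k) : x ∈ D i ↔ ξ x = i := by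
      have : x ∉ symmDiff (ξ ⁻¹' {i}) (D i) := fun h => hcon (by simpa using ⟨i, h⟩)
      simp only [mem_symmDiff, mem_preimage, mem_singleton_iff] at this
      tauto
    have hs : {i | x ∈ D i} = {ξ x} := by
      ext i
      simp [hiff, eq_comm]
    simp only [η, G, hs, singleton_nonempty, dite_true]
    exact (mem_singleton_iff.1 (singleton_nonempty (ξ x)).some_mem).symm
  calc P.real {x | ξ x ≠ F fun t : Fin (2 * M + 1) => x (t - M)}
      ≤ P.real (⋃ i ∈ (Finset.univ : Finset (Fin k)), symmDiff (ξ ⁻¹' {i}) (D i)) :=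
        measureReal_mono hsub (measure_ne_top _ _)
    _ ≤ ∑ i, P.real (symmDiff (ξ ⁻¹' {i}) (D i)) := measureReal_biUnion_finset_le _ _
    _ < ∑ _i : Fin k, ε / k := by
        refine Finset.sum_lt_sum_of_nonempty ⟨0, Finset.mem_univ _⟩ fun i _ => ?_
        rw [measureReal_def]
        exact (ENNReal.lt_ofReal_iff_toReal_lt (measure_ne_top _ _)).1 (hDε i)
    _ = ε := by simp; field_simp

variable [Fintype A] [MeasurableSingletonClass A]

/-- For a shift-invariant measure, the metric entropy is at most the Shannon entropy of a single
coordinate: the coordinate partition generates. -/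
lemma metricEntropy_shift_le {P : Measure (ℤ → A)} [IsProbabilityMeasure P]
    (hP : MeasurePreserving (shift (1 : ℤ)) P P) :
    metricEntropy (shift (1 : ℤ)) P ≤ ((shannonEntropy P fun x => x 0 : ℝ) : EReal) := by
  set h := shannonEntropy P fun x => x 0 with hh
  refine iSup_le fun k => iSup_le fun ξ => iSup_le fun hξ => ?_
  have : NeZero k := by
    constructor
    rintro rfl
    obtain ⟨x⟩ : Nonempty (ℤ → A) := P.nonempty_of_neZero
    exact (ξ x).elim0
  -- all coordinates have the same entropy
  have hcoord (c : ℤ) : shannonEntropy P (fun x => x c) = h := by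
    have hnat (n : ℕ) (c : ℤ) : shannonEntropy P (fun x => x (n + c)) =
        shannonEntropy P fun x => x c := by
      rw [← shannonEntropy_comp_measurePreserving (hP.iterate n) (measurable_pi_apply c)]
      congr 1
      ext x
      simp [iterate_shift_one]
    rcases Int.eq_nat_or_neg c with ⟨n, rfl | rfl⟩
    · simpa using hnat n 0
    · simpa using (hnat n (-n)).symm
  have key (δ : ℝ) (hδ : 0 < δ) : partitionEntropy (shift (1 : ℤ)) P ξ ≤ ((h + δ : ℝ) : EReal) := by
    obtain ⟨ε, hε, hsmall⟩ := exists_shannonEntropy_lt (Fin k) 0 hδ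
    obtain ⟨m, F, hF⟩ := exists_window_approx P hξ hε
    set η : (ℤ → A) → Fin k := fun x => F fun t => x (t - m) with hηdef
    have hη : Measurable η := (measurable_of_finite F).comp
      (measurable_pi_lambda _ fun t => measurable_pi_apply _)
    set e : (ℤ → A) → Fin k := fun x => ξ x - η x with hedef
    have he : Measurable e :=
      (measurable_of_finite fun p : Fin k × Fin k => p.1 - p.2).comp (hξ.prodMk hη)
    have heδ : shannonEntropy P e < δ := by
      refine hsmall P e he ?_
      simpa [hedef, sub_eq_zero] using hF
    have hbound (n : ℕ) : refinedEntropy (shift (1 : ℤ)) P ξ n ≤ (n + 2 * m) * h + n * δ := by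
      rw [refinedEntropy_eq_shannonEntropy]
      set V : (ℤ → A) → Fin (n + 2 * m) → A := fun x i => x (i - m) with hV
      set E : (ℤ → A) → Fin n → Fin k := fun x i => e ((shift (1 : ℤ))^[i] x) with hE
      have hVm : Measurable V := measurable_pi_lambda _ fun i => measurable_pi_apply _
      have hEm : Measurable E := measurable_pi_lambda _ fun i =>
        he.comp ((measurable_shift 1).iterate i)
      have h1 : shannonEntropy P V ≤ (n + 2 * m) * h := by
        refine (shannonEntropy_pi_le (X := fun (i : Fin (n + 2 * m)) (x : ℤ → A) => x (i - m))
          fun i => measurable_pi_apply _).trans ?_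
        simp [hcoord]
      have h2 : shannonEntropy P E ≤ n * δ := by
        refine (shannonEntropy_pi_le (X := fun (i : Fin n) (x : ℤ → A) =>
          e ((shift (1 : ℤ))^[i] x)) fun i => he.comp ((measurable_shift 1).iterate i)).trans ?_
        have (i : Fin n) : shannonEntropy P (fun x => e ((shift (1 : ℤ))^[i] x)) ≤ δ :=
          (shannonEntropy_comp_measurePreserving (hP.iterate i) he).trans_le heδ.le
        refine (Finset.sum_le_sum fun i _ => this i).trans ?_
        simp
      -- `ξ` along the orbit is determined by the window `V` and the correction `E`
      let g : (Fin (n + 2 * m) → A) × (Fin n → Fin k) → Fin n → Fin k := fun p i =>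
        p.2 i + F fun t => p.1 ⟨i + t, by omega⟩
      have h3 : (fun x (i : Fin n) => ξ ((shift (1 : ℤ))^[i] x)) = g ∘ fun x => (V x, E x) := by
        ext x i
        have : (fun t : Fin (2 * m + 1) => (shift (1 : ℤ))^[i] x (t - m)) =
            fun t : Fin (2 * m + 1) => V x ⟨i + t, by omega⟩ := by
          ext t
          rw [iterate_shift_one]
          simp only [hV]
          congr 1
          push_cast
          ring
        simp [g, hE, hedef, hηdef, this]
      rw [h3]
      have h4 := shannonEntropy_comp_le (μ := P) (hVm.prodMk hEm) g
      have h5 := shannonEntropy_prodMk_le (μ := P) hVm hEm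
      linarith
    have hlim : Tendsto (fun n : ℕ => ((h + δ + 2 * m * h * (n : ℝ)⁻¹ : ℝ) : EReal)) atTop
        (𝓝 ((h + δ : ℝ) : EReal)) := by
      refine (continuous_coe_real_ereal.tendsto _).comp ?_
      simpa using (tendsto_const_nhds (x := h + δ)).add
        ((tendsto_inv_atTop_nhds_zero_nat (𝕜 := ℝ)).const_mul (2 * m * h))
    rw [← hlim.limsup_eq]
    refine limsup_le_limsup ?_
    filter_upwards [eventually_gt_atTop 0] with n hn
    have hn' : (0 : ℝ) < n := by exact_mod_cast hn
    rw [EReal.coe_le_coe_iff, div_le_iff₀ hn']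
    refine (hbound n).trans (le_of_eq ?_)
    field_simp
    ring
  refine ge_of_tendsto (f := fun δ : ℝ => ((h + δ : ℝ) : EReal)) (x := 𝓝[>] 0) ?_
    (eventually_mem_nhdsWithin.mono fun δ hδ => key δ hδ)
  have : Tendsto (fun δ : ℝ => ((h + δ : ℝ) : EReal)) (𝓝 0) (𝓝 ((h + 0 : ℝ) : EReal)) :=
    (continuous_coe_real_ereal.comp (continuous_const.add continuous_id)).tendsto 0
  rw [add_zero] at this
  exact this.mono_left nhdsWithin_le_nhds

end MetricEntropy

/-! ### Bernoulli measures on the full shift -/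

section Bernoulli

variable {A : Type*} [MeasurableSpace A] (p : Measure A) [IsProbabilityMeasure p]

lemma measurePreserving_shift_infinitePi (g : ℤ) :
    MeasurePreserving (shift g) (Measure.infinitePi fun _ : ℤ => p)
      (Measure.infinitePi fun _ : ℤ => p) := by
  refine ⟨measurable_shift g, Measure.eq_infinitePi _ fun s t ht => ?_⟩
  rw [Measure.map_apply (measurable_shift g)
    (MeasurableSet.pi s.countable_toSet fun i _ => ht i)]
  have : shift g ⁻¹' (s : Set ℤ).pi t =
      ((s.map (addLeftEmbedding g) : Finset ℤ) : Set ℤ).pi fun c => t (c - g) := by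
    ext x
    simp only [mem_preimage, Set.mem_pi, SymbolicDynamics.FullShift.shift_apply, Finset.coe_map,
      addLeftEmbedding_apply, forall_mem_image, add_sub_cancel_left]
  rw [this, Measure.infinitePi_pi _ fun i _ => ht _]
  simp

/-- Events that depend on disjoint blocks of coordinates are independent: a shift by more than the
length of the window decouples a cylinder from itself. -/
lemma exists_infinitePi_inter_shift_eq {D : Set (ℤ → A)}
    (hD : D ∈ measurableCylinders fun _ : ℤ => A) :
    ∃ N : ℕ, (Measure.infinitePi fun _ : ℤ => p) (D ∩ (shift (1 : ℤ))^[N] ⁻¹' D) =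
      (Measure.infinitePi fun _ : ℤ => p) D * (Measure.infinitePi fun _ : ℤ => p) D := by
  set P := Measure.infinitePi fun _ : ℤ => p
  obtain ⟨s, S, hS, rfl⟩ := (mem_measurableCylinders D).1 hD
  set m := s.sup Int.natAbs with hm
  have hs (c : ℤ) (hc : c ∈ s) : |c| ≤ m := by
    rw [Int.abs_eq_natAbs]
    exact_mod_cast Finset.le_sup (f := Int.natAbs) hc
  refine ⟨2 * m + 1, ?_⟩
  set N := 2 * m + 1 with hN
  set t : Finset ℤ := s.map (addLeftEmbedding (N : ℤ)) with ht
  have hst : Disjoint s t := by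
    rw [Finset.disjoint_left]
    intro c hc hct
    simp only [ht, Finset.mem_map, addLeftEmbedding_apply] at hct
    obtain ⟨d, hd, rfl⟩ := hct
    have h1 := abs_le.1 (hs _ hc)
    have h2 := abs_le.1 (hs _ hd)
    omega
  have hind : IndepFun (fun (x : ℤ → A) (i : s) => x i) (fun (x : ℤ → A) (i : t) => x i) P :=
    (iIndepFun_infinitePi (P := fun _ : ℤ => p) (X := fun _ a => a)
      fun _ => measurable_id).indepFun_finset s t hst fun i => measurable_pi_apply i
  let f : (t → A) → s → A := fun y i => y ⟨N + i, by simp [ht]⟩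
  have hf : Measurable f := measurable_pi_lambda _ fun i => measurable_pi_apply _
  have h := hind.measure_inter_preimage_eq_mul S (f ⁻¹' S) hS (hf hS)
  have h1 : (fun (x : ℤ → A) (i : s) => x i) ⁻¹' S = cylinder s S := rfl
  have h2 : (fun (x : ℤ → A) (i : t) => x i) ⁻¹' (f ⁻¹' S) =
      (shift (1 : ℤ))^[N] ⁻¹' cylinder s S := by
    ext x
    simp only [mem_preimage, mem_cylinder, f]
    congr! 1
    ext i
    simp [iterate_shift_one]
  rw [h1, h2] at h
  rw [h, ((measurePreserving_shift_infinitePi p 1).iterate N).measure_preimage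
    hS.cylinder.nullMeasurableSet]

theorem ergodic_shift_infinitePi :
    Ergodic (shift (1 : ℤ)) (Measure.infinitePi fun _ : ℤ => p) := by
  set P := Measure.infinitePi fun _ : ℤ => p with hP
  have hmp := measurePreserving_shift_infinitePi p 1
  rw [← hP] at hmp
  refine ⟨hmp, ⟨fun s hs hinv => ?_⟩⟩
  have hdense : P.MeasureDense (measurableCylinders fun _ : ℤ => A) :=
    Measure.MeasureDense.of_generateFrom_isSetAlgebra_finite P isSetAlgebra_measurableCylinders
      generateFrom_measurableCylinders.symm
  -- approximating by cylinders, an invariant set is independent of itself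
  have hclose (ε : ℝ) (hε : 0 < ε) : |P.real s - P.real s * P.real s| ≤ ε := by
    obtain ⟨D, hD, hDε⟩ := hdense.approx s hs (measure_ne_top _ _) (ε / 4) (by positivity)
    have hDm : MeasurableSet D := .of_mem_measurableCylinders hD
    obtain ⟨N, hN⟩ := exists_infinitePi_inter_shift_eq p hD
    have hδ : P.real (symmDiff s D) < ε / 4 := by
      rw [measureReal_def]
      exact (ENNReal.lt_ofReal_iff_toReal_lt (measure_ne_top _ _)).1 hDε
    have hdiff (u v : Set (ℤ → A)) (hu : MeasurableSet u) (hv : MeasurableSet v) :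
        |P.real u - P.real v| ≤ P.real (symmDiff u v) :=
      abs_measureReal_sub_le_measureReal_symmDiff hu.nullMeasurableSet hv.nullMeasurableSet
    set T := (shift (1 : ℤ) : (ℤ → A) → ℤ → A)^[N] with hT
    have hTm : Measurable T := (measurable_shift 1).iterate N
    have hinvN : T ⁻¹' s = s := by
      rw [hT]
      exact (Function.IsFixedPt.preimage_iterate hinv N)
    have h1 : |P.real s - P.real D| ≤ ε / 4 := (hdiff s D hs hDm).trans hδ.le
    have h2 : |P.real s - P.real (D ∩ T ⁻¹' D)| ≤ ε / 4 + ε / 4 := by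
      refine (hdiff s _ hs (hDm.inter (hTm hDm))).trans ?_
      have hsub : symmDiff s (D ∩ T ⁻¹' D) ⊆ symmDiff s D ∪ T ⁻¹' symmDiff s D := by
        intro x hx
        have hxs : T x ∈ s ↔ x ∈ s := by
          rw [← mem_preimage, hinvN]
        simp only [mem_symmDiff, mem_inter_iff, mem_preimage, mem_union] at hx ⊢
        tauto
      refine (measureReal_mono hsub).trans ((measureReal_union_le _ _).trans ?_)
      rw [(hmp.iterate N).measureReal_preimage (hs.symmDiff hDm).nullMeasurableSet]
      linarith
    have h3 : P.real (D ∩ T ⁻¹' D) = P.real D * P.real D := by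
      simp only [measureReal_def, ← ENNReal.toReal_mul, ← hN, hP]
    rw [h3] at h2
    have h4 : |P.real D * P.real D - P.real s * P.real s| ≤ 2 * (ε / 4) := by
      have : P.real D * P.real D - P.real s * P.real s =
          -((P.real D + P.real s) * (P.real s - P.real D)) := by ring
      rw [this, abs_neg, abs_mul]
      refine mul_le_mul ?_ h1 (abs_nonneg _) (by norm_num)
      rw [abs_of_nonneg (by positivity)]
      linarith [measureReal_le_one (μ := P) (s := D), measureReal_le_one (μ := P) (s := s)]
    calc |P.real s - P.real s * P.real s|
        ≤ |P.real s - P.real D * P.real D| + |P.real D * P.real D - P.real s * P.real s| :=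
          abs_sub_le _ _ _
      _ ≤ ε := by linarith
  have h0 : P.real s - P.real s * P.real s = 0 :=
    abs_nonpos_iff.1 (le_of_forall_pos_le_add fun ε hε => by simpa using hclose ε hε)
  have h01 : P.real s * (1 - P.real s) = 0 := by linarith
  rw [eventuallyConst_set']
  rcases mul_eq_zero.1 h01 with h | h
  · left
    rw [ae_eq_empty]
    exact (measureReal_eq_zero_iff).1 h
  · right
    have h' : P.real s = 1 := by linarith
    rw [ae_eq_univ, ← measureReal_eq_zero_iff, probReal_compl_eq_one_sub hs, h', sub_self]

/-- The word `w` of length `n` has probability `∏ p(wᵢ)`. -/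
lemma infinitePi_real_word [Fintype A] [MeasurableSingletonClass A] {n : ℕ} (w : Fin n → A) :
    (Measure.infinitePi fun _ : ℤ => p).real {x | ∀ i : Fin n, x i = w i} =
      ∏ i, p.real {w i} := by
  let e : Fin n ↪ ℤ := Fin.valEmbedding.trans Nat.castEmbedding
  have hw : {x : ℤ → A | ∀ i : Fin n, x i = w i} =
      ((Finset.univ.map e : Finset ℤ) : Set ℤ).pi fun c =>
        {a | ∀ i : Fin n, (i : ℤ) = c → a = w i} := by
    ext x
    simp only [mem_ofPred_eq, Set.mem_pi, Finset.coe_map, Finset.coe_univ, image_univ, mem_range]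
    constructor
    · rintro h _ ⟨i, rfl⟩ j hj
      rw [← h j, hj]
    · exact fun h i => h i ⟨i, rfl⟩ i rfl
  rw [measureReal_def, hw, Measure.infinitePi_pi _ fun i _ => (Set.toFinite _).measurableSet]
  simp only [Finset.prod_map, ENNReal.toReal_prod, measureReal_def]
  refine Finset.prod_congr rfl fun i _ => ?_
  congr 2
  ext a
  simp only [e, mem_ofPred_eq, mem_singleton_iff]
  constructor
  · exact fun h => h i rfl
  · rintro rfl j hj
    congr 1
    simp [Fin.ext_iff] at hj ⊢
    omega

/-- Entropy is additive on product weights. -/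
lemma sum_negMulLog_prod {A : Type*} [Fintype A] (q : A → ℝ) (hq : ∑ a, q a = 1) (n : ℕ) :
    ∑ w : Fin n → A, Real.negMulLog (∏ i, q (w i)) = n * ∑ a, Real.negMulLog (q a) := by
  induction n with
  | zero => simp
  | succ n ih =>
    have hone : ∑ w : Fin n → A, ∏ i, q (w i) = 1 := by
      rw [← Fintype.piFinset_univ, ← Finset.prod_univ_sum]
      simp [hq]
    rw [← (Fin.consEquiv fun _ : Fin (n + 1) => A).sum_comp, Fintype.sum_prod_type]
    simp only [Fin.consEquiv_apply, Fin.prod_univ_succ, Fin.cons_zero, Fin.cons_succ,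
      Real.negMulLog_mul, Finset.sum_add_distrib, ← Finset.mul_sum, ← Finset.sum_mul, ih, hq, hone]
    push_cast
    ring

/-- The metric entropy of the Bernoulli shift with weights `p` is `-∑ p(a) log p(a)`. -/
theorem metricEntropy_shift_infinitePi {k : ℕ} (p : Measure (Fin k)) [IsProbabilityMeasure p] :
    metricEntropy (shift (1 : ℤ)) (Measure.infinitePi fun _ : ℤ => p) =
      ((∑ a, Real.negMulLog (p.real {a}) : ℝ) : EReal) := by
  have hp : ∑ a, p.real {a} = 1 := by
    simp
  refine le_antisymm ?_ ?_
  · refine (metricEntropy_shift_le (measurePreserving_shift_infinitePi p 1)).trans_eq ?_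
    congr 1
    have h := measurePreserving_eval_infinitePi (fun _ : ℤ => p) 0
    exact shannonEntropy_comp_measurePreserving h (X := id) measurable_id
  · refine le_iSup_of_le k (le_iSup_of_le (fun x => x 0) (le_iSup_of_le (measurable_pi_apply 0) ?_))
    unfold partitionEntropy
    refine le_of_eq (Tendsto.limsup_eq ?_).symm
    refine tendsto_const_nhds.congr' ?_
    filter_upwards [eventually_gt_atTop 0] with n hn
    have hn' : (n : ℝ) ≠ 0 := by exact_mod_cast hn.ne'
    unfold refinedEntropy
    simp only [iterate_shift_one, add_zero, infinitePi_real_word]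
    rw [sum_negMulLog_prod _ hp]
    field_simp

end Bernoulli

/-! ### Counting the words of the subshift -/

section Words

variable {L ν : ℕ} {τ : ℝ}

lemma zero_notMem_colour (j : Fin L) : (0 : Letter L ν) ∉ colour ν j := by
  simp [colour]

lemma exists_mem_colour (hν : 0 < ν) {s : Letter L ν} (hs : s ≠ 0) :
    ∃ j : Fin L, s ∈ colour ν j := by
  have h0 : (s : ℕ) ≠ 0 := fun h => hs (Fin.ext h)
  have hlt : (s : ℕ) - 1 < L * ν := by have := s.2; omega
  refine ⟨⟨((s : ℕ) - 1) / ν, (Nat.div_lt_iff_lt_mul hν).2 hlt⟩, ?_⟩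
  have h1 := Nat.div_mul_le_self ((s : ℕ) - 1) ν
  have h2 := Nat.lt_div_mul_add (a := (s : ℕ) - 1) hν
  simp only [colour, mem_ofPred_eq, add_mul, one_mul]
  omega

lemma eq_of_mem_colour {s : Letter L ν} {i j : Fin L} (hi : s ∈ colour ν i)
    (hj : s ∈ colour ν j) : i = j := by
  by_contra hne
  have hne' : (i : ℕ) ≠ j := fun h => hne (Fin.ext h)
  simp only [colour, mem_ofPred_eq] at hi hj
  rcases Nat.lt_or_gt_of_ne hne' with h | h
  · have := Nat.mul_le_mul_right ν (Nat.succ_le_of_lt h)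
    simp only [Nat.succ_eq_add_one] at this
    omega
  · have := Nat.mul_le_mul_right ν (Nat.succ_le_of_lt h)
    simp only [Nat.succ_eq_add_one] at this
    omega

lemma disjoint_colour {i j : Fin L} (h : i ≠ j) : Disjoint (colour ν i) (colour ν j) :=
  Set.disjoint_left.2 fun _ hi hj => h (eq_of_mem_colour hi hj)

lemma ncard_colour (j : Fin L) : (colour ν j).ncard = ν := by
  have hj : ((j : ℕ) + 1) * ν ≤ L * ν := Nat.mul_le_mul_right ν j.2
  have hadd : ((j : ℕ) + 1) * ν = j * ν + ν := by ring
  have himg : (Fin.val '' colour ν j : Set ℕ) = Finset.Icc ((j : ℕ) * ν + 1) ((j + 1) * ν) := by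
    ext s
    simp only [colour, mem_image, mem_ofPred_eq, Finset.coe_Icc, mem_Icc]
    constructor
    · rintro ⟨t, ht, rfl⟩
      exact ht
    · exact fun hs => ⟨⟨s, by omega⟩, hs, rfl⟩
  rw [← Set.ncard_image_of_injective _ Fin.val_injective, himg, Set.ncard_coe_finset,
    Nat.card_Icc, hadd]
  omega

/-- The word `x_m x_{m+1} ⋯ x_{m+n-1}`. -/
def wordAt {A : Type*} (x : ℤ → A) (m : ℤ) (n : ℕ) : List A :=
  List.ofFn fun i : Fin n => x (m + i)

lemma wordAt_add {A : Type*} (x : ℤ → A) (m : ℤ) (a b : ℕ) :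
    wordAt x m (a + b) = wordAt x m a ++ wordAt x (m + a) b := by
  simp only [wordAt, List.ofFn_add]
  simp [add_assoc]

lemma wordAt_eq_replicate {A : Type*} {x : ℤ → A} {m : ℤ} {n : ℕ} {s : A}
    (h : ∀ i < n, x (m + i) = s) : wordAt x m n = List.replicate n s := by
  rw [wordAt, ← List.ofFn_const]
  congr 1
  ext i
  exact h i i.2

/-- The words of length `a` in the symbols of colour `j`. -/
noncomputable def colourWords (ν : ℕ) (j : Fin L) (a : ℕ) : Finset (List (Letter L ν)) :=
  open Classical in
  (Fintype.piFinset fun _ : Fin a => (colour ν j).toFinset).image List.ofFn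

lemma card_colourWords_le (j : Fin L) (a : ℕ) : (colourWords ν j a).card ≤ ν ^ a := by
  classical
  refine Finset.card_image_le.trans ?_
  rw [Fintype.card_piFinset]
  simp only [Finset.prod_const, Finset.card_univ, Fintype.card_fin]
  rw [← Set.ncard_eq_toFinset_card', ncard_colour]

lemma wordAt_mem_colourWords {x : ℤ → Letter L ν} {m : ℤ} {j : Fin L} {a : ℕ}
    (h : ∀ i < a, x (m + i) ∈ colour ν j) : wordAt x m a ∈ colourWords ν j a := by
  classical
  refine Finset.mem_image.2 ⟨fun i => x (m + i), ?_, rfl⟩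
  simpa [Fintype.mem_piFinset] using fun i : Fin a => h i i.2

lemma exists_maximal_run (q : ℕ → Prop) (n : ℕ) :
    ∃ a ≤ n, (∀ i < a, q i) ∧ (a < n → ¬ q a) := by
  induction n with
  | zero => exact ⟨0, le_rfl, by simp, by simp⟩
  | succ n ih =>
    obtain ⟨a, han, h1, h2⟩ := ih
    rcases han.lt_or_eq with h | rfl
    · exact ⟨a, by omega, h1, fun _ => h2 h⟩
    · by_cases hq : q a
      · refine ⟨a + 1, le_rfl, fun i hi => ?_, by simp⟩
        rcases Nat.lt_succ_iff_lt_or_eq.1 hi with hi | rfl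
        · exact h1 i hi
        · exact hq
      · exact ⟨a, by omega, h1, fun _ => hq⟩

lemma mem_colour_of_run {x : ℤ → Letter L ν} (hx : x ∈ colouredSequences L ν τ) {m : ℤ}
    {j : Fin L} (hm : x m ∈ colour ν j) {a : ℕ} (h : ∀ i < a, x (m + i) ≠ 0) :
    ∀ i < a, x (m + i) ∈ colour ν j := by
  intro i hi
  induction i with
  | zero => simpa using hm
  | succ i ih =>
    have h1 := ih (by omega)
    obtain ⟨j', h2, h3⟩ := hx.1 (m + i) (h i (by omega)) (by
      have := h (i + 1) hi
      push_cast at this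
      rwa [← add_assoc] at this)
    rw [eq_of_mem_colour h1 h2]
    push_cast
    rwa [← add_assoc]

/-- The decomposition of a word beginning with colour `j`: after its first coloured block come only
zeros, or a string of zeros, of length at least `τ (a + 1)`, and a word beginning with an adjacent
colour. -/
lemma exists_decomposition {x : ℤ → Letter L ν} (hx : x ∈ colouredSequences L ν τ) {m : ℤ}
    {j : Fin L} (hm : x m ∈ colour ν j) {n : ℕ} (hn : 1 ≤ n) :
    ∃ a : ℕ, 1 ≤ a ∧ wordAt x m a ∈ colourWords ν j a ∧
      ((∃ l, a + l = n ∧ wordAt x m n = wordAt x m a ++ List.replicate l 0) ∨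
        ∃ (l : ℕ) (j' : Fin L), a + l < n ∧ τ * (a + 1) ≤ l ∧
          ((j' : ℕ) = j + 1 ∨ (j : ℕ) = j' + 1) ∧ x (m + a + l) ∈ colour ν j' ∧
          wordAt x m n = wordAt x m a ++ List.replicate l 0 ++
            wordAt x (m + a + l) (n - a - l)) := by
  obtain ⟨a, han, ha1, ha2⟩ := exists_maximal_run (fun i => x (m + i) ≠ 0) n
  have hm0 : x m ≠ 0 := fun h => zero_notMem_colour j (h ▸ hm)
  have ha : 1 ≤ a := by
    by_contra h
    obtain rfl : a = 0 := by omega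
    exact ha2 hn (by simpa using hm0)
  have hcol := mem_colour_of_run hx hm ha1
  refine ⟨a, ha, wordAt_mem_colourWords hcol, ?_⟩
  obtain ⟨l, hln, hl1, hl2⟩ := exists_maximal_run (fun i => x (m + a + i) = 0) (n - a)
  rcases hln.lt_or_eq with h | h
  · right
    have hne : x (m + a + l) ≠ 0 := hl2 h
    have hl : 1 ≤ l := by
      by_contra h'
      obtain rfl : l = 0 := by omega
      exact ha2 (by omega) (by simpa using hne)
    obtain ⟨hτ, i, j', hij, hi, hj'⟩ := hx.2 m a l 1 ha hl le_rfl ha1 hl1 (by simpa using hne)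
    have hji : j = i := eq_of_mem_colour hm (by simpa using hi 0 ha)
    subst hji
    refine ⟨l, j', by omega, by simpa using hτ, hij, by simpa using hj' 0 one_pos, ?_⟩
    conv_lhs => rw [show n = a + l + (n - a - l) by omega]
    rw [wordAt_add, wordAt_add, wordAt_eq_replicate hl1]
    push_cast
    rw [← add_assoc]
  · left
    refine ⟨l, by omega, ?_⟩
    conv_lhs => rw [show n = a + l by omega]
    rw [wordAt_add, wordAt_eq_replicate hl1]

lemma sum_pow_Icc_le (hν : 2 ≤ ν) (n : ℕ) :
    ∑ a ∈ Finset.Icc 1 n, (ν : ℝ) ^ a ≤ 2 * (ν : ℝ) ^ n := by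
  have hν' : (2 : ℝ) ≤ ν := by exact_mod_cast hν
  induction n with
  | zero => simp
  | succ n ih =>
    rw [Finset.sum_Icc_succ_top (by omega), pow_succ]
    have : (0 : ℝ) ≤ (ν : ℝ) ^ n := by positivity
    nlinarith

/-- The strings of zeros admissible after a coloured block of length `a` contribute at most
`2 · 5⁻⁽ᵃ⁺¹⁾`, since `ν ^ τ ≥ 5`. -/
lemma sum_gap_le (hν : 2 ≤ ν) (hτ : Real.log 5 / Real.log ν ≤ τ) (a n : ℕ) :
    ∑ l ∈ Finset.range n with τ * (a + 1) ≤ (l : ℕ), ((ν : ℝ)⁻¹) ^ l ≤ 2 * (5⁻¹) ^ (a + 1) := by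
  have hν' : (2 : ℝ) ≤ ν := by exact_mod_cast hν
  have hν0 : (0 : ℝ) < ν := by linarith
  have hlog : 0 < Real.log ν := Real.log_pos (by linarith)
  have hinv : (ν : ℝ)⁻¹ ≤ 2⁻¹ := inv_anti₀ (by norm_num) hν'
  set l₀ := ⌈τ * (a + 1)⌉₊ with hl₀
  have h5 : (5 : ℝ) ^ (a + 1) ≤ (ν : ℝ) ^ l₀ := by
    rw [← Real.log_le_log_iff (by positivity) (by positivity), Real.log_pow, Real.log_pow]
    have h1 : Real.log 5 ≤ τ * Real.log ν := (div_le_iff₀ hlog).1 hτ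
    have h2 : τ * (a + 1) ≤ l₀ := Nat.le_ceil _
    calc ((a + 1 : ℕ) : ℝ) * Real.log 5 ≤ ((a + 1 : ℕ) : ℝ) * (τ * Real.log ν) := by gcongr
      _ = τ * (a + 1) * Real.log ν := by push_cast; ring
      _ ≤ l₀ * Real.log ν := by gcongr
  calc ∑ l ∈ Finset.range n with τ * (a + 1) ≤ (l : ℕ), ((ν : ℝ)⁻¹) ^ l
      ≤ ∑ l ∈ Finset.Ico l₀ n, ((ν : ℝ)⁻¹) ^ l := by
        refine Finset.sum_le_sum_of_subset_of_nonneg (fun l hl => ?_) fun _ _ _ => by positivity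
        simp only [Finset.mem_filter, Finset.mem_range] at hl
        exact Finset.mem_Ico.2 ⟨Nat.ceil_le.2 hl.2, hl.1⟩
    _ ≤ ((ν : ℝ)⁻¹) ^ l₀ / (1 - (ν : ℝ)⁻¹) :=
        geom_sum_Ico_le_of_lt_one (by positivity) (by linarith)
    _ ≤ ((ν : ℝ)⁻¹) ^ l₀ / 2⁻¹ := by
        gcongr
        linarith
    _ = 2 * ((ν : ℝ) ^ l₀)⁻¹ := by rw [inv_pow]; ring
    _ ≤ 2 * (5⁻¹) ^ (a + 1) := by
        rw [inv_pow]
        gcongr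

lemma card_adjacent_le (j : Fin L) :
    (Finset.univ.filter fun j' : Fin L => (j' : ℕ) = j + 1 ∨ (j : ℕ) = j' + 1).card ≤ 2 := by
  rw [Finset.filter_or]
  refine (Finset.card_union_le _ _).trans ?_
  have h1 : (Finset.univ.filter fun j' : Fin L => (j' : ℕ) = j + 1).card ≤ 1 :=
    Finset.card_le_one.2 fun a ha b hb => by
      simp only [Finset.mem_filter] at ha hb
      exact Fin.ext (by omega)
  have h2 : (Finset.univ.filter fun j' : Fin L => (j : ℕ) = j' + 1).card ≤ 1 :=
    Finset.card_le_one.2 fun a ha b hb => by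
      simp only [Finset.mem_filter] at ha hb
      exact Fin.ext (by omega)
  omega

/-- At most `(5/2) νⁿ` words of length `n` begin with a given colour. In the recursion over the
first coloured block, words with no second block number at most `2 νⁿ`, and the others at most
`2 · (5/2) νⁿ · ∑ₐ 2 · 5⁻⁽ᵃ⁺¹⁾ ≤ νⁿ / 2`. -/
lemma exists_finset_words_of_colour (hν : 2 ≤ ν) (hτ : Real.log 5 / Real.log ν ≤ τ) (n : ℕ)
    (j : Fin L) : ∃ S : Finset (List (Letter L ν)), (S.card : ℝ) ≤ 5 / 2 * (ν : ℝ) ^ n ∧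
      ∀ x ∈ colouredSequences L ν τ, ∀ m : ℤ, 1 ≤ n → x m ∈ colour ν j → wordAt x m n ∈ S := by
  classical
  induction n using Nat.strong_induction_on generalizing j with
  | _ n ih =>
  have hν0 : (0 : ℝ) < ν := by exact_mod_cast (by omega : 0 < ν)
  have ih' (k : ℕ) (j : Fin L) : ∃ S : Finset (List (Letter L ν)), k < n →
      (S.card : ℝ) ≤ 5 / 2 * (ν : ℝ) ^ k ∧
      ∀ x ∈ colouredSequences L ν τ, ∀ m : ℤ, 1 ≤ k → x m ∈ colour ν j → wordAt x m k ∈ S := by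
    by_cases hk : k < n
    · obtain ⟨S, hS⟩ := ih k hk j
      exact ⟨S, fun _ => hS⟩
    · exact ⟨∅, fun h => absurd h hk⟩
  choose R hR using ih'
  set adj : Finset (Fin L) :=
    Finset.univ.filter fun j' : Fin L => (j' : ℕ) = j + 1 ∨ (j : ℕ) = j' + 1 with hadj
  set gaps : ℕ → Finset ℕ := fun a => (Finset.range (n - a)).filter fun l => τ * (a + 1) ≤ (l : ℕ)
    with hgaps
  let S₁ : Finset (List (Letter L ν)) := (Finset.Icc 1 n).biUnion fun a =>
    (colourWords ν j a).image fun u => u ++ List.replicate (n - a) 0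
  let S₂ : Finset (List (Letter L ν)) := (Finset.Icc 1 n).biUnion fun a =>
    (gaps a).biUnion fun l => adj.biUnion fun j' =>
      (colourWords ν j a ×ˢ R (n - a - l) j').image fun p => p.1 ++ List.replicate l 0 ++ p.2
  refine ⟨S₁ ∪ S₂, ?_, ?_⟩
  · have h1 : (S₁.card : ℝ) ≤ 2 * (ν : ℝ) ^ n := by
      refine le_trans ?_ (sum_pow_Icc_le hν n)
      have : S₁.card ≤ ∑ a ∈ Finset.Icc 1 n, ν ^ a :=
        Finset.card_biUnion_le.trans (Finset.sum_le_sum fun a _ =>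
          Finset.card_image_le.trans (card_colourWords_le j a))
      exact_mod_cast this
    have h2 : (S₂.card : ℝ) ≤ 1 / 2 * (ν : ℝ) ^ n := by
      have hcard : S₂.card ≤ ∑ a ∈ Finset.Icc 1 n, ∑ l ∈ gaps a, ∑ j' ∈ adj,
          ν ^ a * (R (n - a - l) j').card := by
        refine Finset.card_biUnion_le.trans (Finset.sum_le_sum fun a _ => ?_)
        refine Finset.card_biUnion_le.trans (Finset.sum_le_sum fun l _ => ?_)
        refine Finset.card_biUnion_le.trans (Finset.sum_le_sum fun j' _ => ?_)
        refine Finset.card_image_le.trans ?_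
        rw [Finset.card_product]
        exact Nat.mul_le_mul_right _ (card_colourWords_le j a)
      calc (S₂.card : ℝ) ≤ ∑ a ∈ Finset.Icc 1 n, ∑ l ∈ gaps a, ∑ j' ∈ adj,
            (ν : ℝ) ^ a * (R (n - a - l) j').card := by exact_mod_cast hcard
        _ ≤ ∑ a ∈ Finset.Icc 1 n, ∑ l ∈ gaps a, 5 * (ν : ℝ) ^ n * ((ν : ℝ)⁻¹) ^ l := by
          refine Finset.sum_le_sum fun a ha => Finset.sum_le_sum fun l hl => ?_
          rw [Finset.mem_Icc] at ha
          simp only [hgaps, Finset.mem_filter, Finset.mem_range] at hl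
          have hterm (j' : Fin L) : (ν : ℝ) ^ a * (R (n - a - l) j').card ≤
              5 / 2 * ((ν : ℝ) ^ n * ((ν : ℝ)⁻¹) ^ l) := by
            have hRc := (hR (n - a - l) j' (by omega)).1
            have hpow : (ν : ℝ) ^ n * ((ν : ℝ)⁻¹) ^ l = (ν : ℝ) ^ a * (ν : ℝ) ^ (n - a - l) := by
              conv_lhs => rw [show n = a + (n - a - l) + l by omega]
              rw [pow_add, pow_add, inv_pow]
              field_simp
            rw [hpow]
            calc (ν : ℝ) ^ a * (R (n - a - l) j').card
                ≤ (ν : ℝ) ^ a * (5 / 2 * (ν : ℝ) ^ (n - a - l)) := by gcongr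
              _ = _ := by ring
          calc ∑ j' ∈ adj, (ν : ℝ) ^ a * (R (n - a - l) j').card
              ≤ ∑ _j' ∈ adj, 5 / 2 * ((ν : ℝ) ^ n * ((ν : ℝ)⁻¹) ^ l) :=
                Finset.sum_le_sum fun j' _ => hterm j'
            _ = adj.card * (5 / 2 * ((ν : ℝ) ^ n * ((ν : ℝ)⁻¹) ^ l)) := by simp
            _ ≤ 2 * (5 / 2 * ((ν : ℝ) ^ n * ((ν : ℝ)⁻¹) ^ l)) := by
                gcongr
                exact_mod_cast card_adjacent_le j
            _ = _ := by ring
        _ ≤ ∑ a ∈ Finset.Icc 1 n, 5 * (ν : ℝ) ^ n * (2 * (5⁻¹) ^ (a + 1)) := by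
          refine Finset.sum_le_sum fun a _ => ?_
          rw [← Finset.mul_sum]
          gcongr
          exact sum_gap_le hν hτ a (n - a)
        _ = 2 * (ν : ℝ) ^ n * ∑ a ∈ Finset.Ico 1 (n + 1), (5⁻¹ : ℝ) ^ a := by
          rw [Finset.mul_sum]
          refine Finset.sum_congr (by ext; simp) fun a _ => ?_
          rw [pow_succ]
          ring
        _ ≤ 2 * (ν : ℝ) ^ n * ((5⁻¹ : ℝ) ^ 1 / (1 - 5⁻¹)) := by
          gcongr
          exact geom_sum_Ico_le_of_lt_one (by norm_num) (by norm_num)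
        _ = 1 / 2 * (ν : ℝ) ^ n := by norm_num; ring
    have h3 : ((S₁ ∪ S₂).card : ℝ) ≤ S₁.card + S₂.card := by
      exact_mod_cast Finset.card_union_le _ _
    linarith
  · intro x hx m hn hm
    obtain ⟨a, ha, hu, ⟨l, hl, hw⟩ | ⟨l, j', hl, hgap, hjj', hcol, hw⟩⟩ :=
      exists_decomposition hx hm hn
    · refine Finset.mem_union_left _ (Finset.mem_biUnion.2 ⟨a, Finset.mem_Icc.2 ⟨ha, by omega⟩,
        Finset.mem_image.2 ⟨_, hu, ?_⟩⟩)
      rw [hw, show n - a = l by omega]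
    · refine Finset.mem_union_right _ (Finset.mem_biUnion.2 ⟨a, Finset.mem_Icc.2 ⟨ha, by omega⟩,
        Finset.mem_biUnion.2 ⟨l, ?_, Finset.mem_biUnion.2 ⟨j', ?_, Finset.mem_image.2
          ⟨(wordAt x m a, wordAt x (m + a + l) (n - a - l)), ?_, hw.symm⟩⟩⟩⟩)
      · simp only [hgaps, Finset.mem_filter, Finset.mem_range]
        exact ⟨by omega, hgap⟩
      · simpa [hadj] using hjj'
      · exact Finset.mem_product.2
          ⟨hu, (hR (n - a - l) j' (by omega)).2 x hx _ (by omega) hcol⟩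

/-- The subshift has at most `6 L νⁿ` words of length `n`. -/
lemma exists_finset_words (hL : 1 ≤ L) (hν : 2 ≤ ν) (hτ : Real.log 5 / Real.log ν ≤ τ) (n : ℕ) :
    ∃ S : Finset (List (Letter L ν)), S.card ≤ 6 * L * ν ^ n ∧
      ∀ x ∈ colouredSequences L ν τ, ∀ m : ℤ, wordAt x m n ∈ S := by
  classical
  choose R hRc hR using fun k : ℕ => exists_finset_words_of_colour (L := L) hν hτ k
  let S : Finset (List (Letter L ν)) := (Finset.Icc 1 n).biUnion fun k =>
    Finset.univ.biUnion fun j : Fin L => (R k j).image fun v => List.replicate (n - k) 0 ++ v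
  refine ⟨insert (List.replicate n 0) S, ?_, fun x hx m => ?_⟩
  · have hS : (S.card : ℝ) ≤ 5 * L * (ν : ℝ) ^ n := by
      have hcard : S.card ≤ ∑ k ∈ Finset.Icc 1 n, ∑ j : Fin L, (R k j).card :=
        Finset.card_biUnion_le.trans (Finset.sum_le_sum fun k _ =>
          Finset.card_biUnion_le.trans (Finset.sum_le_sum fun j _ => Finset.card_image_le))
      calc (S.card : ℝ) ≤ ∑ k ∈ Finset.Icc 1 n, ∑ j : Fin L, ((R k j).card : ℝ) := by
            exact_mod_cast hcard
        _ ≤ ∑ k ∈ Finset.Icc 1 n, ∑ _j : Fin L, 5 / 2 * (ν : ℝ) ^ k :=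
            Finset.sum_le_sum fun k _ => Finset.sum_le_sum fun j _ => hRc k j
        _ = L * (5 / 2) * ∑ k ∈ Finset.Icc 1 n, (ν : ℝ) ^ k := by
            rw [Finset.mul_sum]
            simp [mul_assoc]
        _ ≤ L * (5 / 2) * (2 * (ν : ℝ) ^ n) := by
            gcongr
            exact sum_pow_Icc_le hν n
        _ = _ := by ring
    have hS' : S.card ≤ 5 * L * ν ^ n := by exact_mod_cast hS
    have h1 : 1 ≤ L * ν ^ n := Nat.mul_pos hL (pow_pos (by omega) n)
    calc (insert (List.replicate n 0) S).card ≤ S.card + 1 := Finset.card_insert_le _ _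
      _ ≤ 5 * L * ν ^ n + L * ν ^ n := by omega
      _ = _ := by ring
  · obtain ⟨z, hzn, hz1, hz2⟩ := exists_maximal_run (fun i => x (m + i) = 0) n
    rcases hzn.lt_or_eq with h | rfl
    · obtain ⟨j, hj⟩ := exists_mem_colour (by omega) (hz2 h)
      refine Finset.mem_insert_of_mem (Finset.mem_biUnion.2 ⟨n - z, Finset.mem_Icc.2
        ⟨by omega, by omega⟩, Finset.mem_biUnion.2 ⟨j, Finset.mem_univ _, Finset.mem_image.2
          ⟨wordAt x (m + z) (n - z), hR _ j x hx _ (by omega) hj, ?_⟩⟩⟩)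
      rw [show n - (n - z) = z by omega]
      conv_rhs => rw [show n = z + (n - z) by omega]
      rw [wordAt_add, wordAt_eq_replicate hz1]
    · rw [wordAt_eq_replicate hz1]
      exact Finset.mem_insert_self _ _

end Words

/-! ### Topological entropy of the subshift -/

section TopologicalEntropy

open Dynamics ExpGrowth
open scoped Uniformity

variable {L ν : ℕ} {τ : ℝ}

lemma mem_colouredSequences_of_forall_mem_colour {x : ℤ → Letter L ν} {j : Fin L}
    (h : ∀ n, x n ∈ colour ν j) : x ∈ colouredSequences L ν τ := by
  refine ⟨fun n _ _ => ⟨j, h n, h (n + 1)⟩, fun n a l b _ hl _ _ h₂ _ => ?_⟩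
  have h0 := h₂ 0 hl
  exact absurd (h0 ▸ h _) (zero_notMem_colour j)

lemma zero_mem_colouredSequences : (fun _ => 0) ∈ colouredSequences L ν τ :=
  ⟨fun _ h => absurd rfl h, fun _ _ _ _ ha _ _ h₁ => absurd rfl (h₁ 0 ha)⟩

lemma iterate_shiftMap_apply (n : ℕ) (x : (colouredSubshift L ν τ).carrier) (c : ℤ) :
    ((shiftMap L ν τ)^[n] x).1 c = x.1 (n + c) := by
  have h : Function.Semiconj (Subtype.val : (colouredSubshift L ν τ).carrier → ℤ → Letter L ν)
      (shiftMap L ν τ) (shift (1 : ℤ)) := fun _ => rfl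
  rw [(h.iterate_right n).eq, iterate_shift_one]

lemma exists_window_of_mem_uniformity
    {U : Set ((colouredSubshift L ν τ).carrier × (colouredSubshift L ν τ).carrier)}
    (hU : U ∈ 𝓤 (colouredSubshift L ν τ).carrier) :
    ∃ m : ℕ, ∀ x y : (colouredSubshift L ν τ).carrier,
      (∀ c : ℤ, |c| ≤ m → x.1 c = y.1 c) → (x, y) ∈ U := by
  rw [uniformity_subtype, mem_comap] at hU
  obtain ⟨V, hV, hVU⟩ := hU
  let W : ℕ → Set ((ℤ → Letter L ν) × (ℤ → Letter L ν)) := fun m =>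
    {p | ∀ c : ℤ, |c| ≤ m → p.1 c = p.2 c}
  have hW : (⨅ m, 𝓟 (W m)) ≤ 𝓤 (ℤ → Letter L ν) := by
    rw [Pi.uniformity]
    refine le_iInf fun c => iInf_le_of_le c.natAbs ?_
    have h : 𝓤 (Letter L ν) = 𝓟 SetRel.id := rfl
    rw [h, comap_principal, principal_mono]
    exact fun p hp => hp c (Int.abs_eq_natAbs c).le
  have hdir : Directed (· ≥ ·) fun m => 𝓟 (W m) := by
    refine Antitone.directed_ge fun m n hmn => principal_mono.2 fun p hp c hc => hp c (hc.trans ?_)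
    exact_mod_cast hmn
  obtain ⟨m, hm⟩ := (mem_iInf_of_directed hdir V).1 (hW hV)
  exact ⟨m, fun x y h => hVU (hm h)⟩

lemma topEntropy_shiftMap_le (hL : 1 ≤ L) (hν : 2 ≤ ν) (hτ : Real.log 5 / Real.log ν ≤ τ) :
    topEntropy (shiftMap L ν τ) ≤ ENNReal.log (ν : ENNReal) := by
  refine iSup₂_le fun U hU => ?_
  obtain ⟨m, hm⟩ := exists_window_of_mem_uniformity hU
  rw [← expGrowthSup_pow]
  refine expGrowthSup_le_of_eventually_le (b := ((6 * L * ν ^ (2 * m + 1) : ℕ) : ENNReal))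
    (ENNReal.natCast_ne_top _) (Eventually.of_forall fun n => ?_)
  obtain ⟨S, hS, hmem⟩ := exists_finset_words (τ := τ) hL hν hτ (n + (2 * m + 1))
  -- choose one point of the subshift for every word of length `n + 2m + 1`
  have hcover : ∃ t : Finset (colouredSubshift L ν τ).carrier, t.card ≤ S.card ∧
      IsDynCoverOf (shiftMap L ν τ) univ U n t := by
    classical
    let f : (colouredSubshift L ν τ).carrier → List (Letter L ν) := fun x =>
      wordAt x.1 (-m) (n + (2 * m + 1))
    obtain ⟨t, htcard, htimg⟩ : ∃ t : Finset (colouredSubshift L ν τ).carrier,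
        t.card ≤ S.card ∧ ∀ x, ∃ y ∈ t, f x = f y := by
      let z : (colouredSubshift L ν τ).carrier := ⟨fun _ => 0, zero_mem_colouredSequences⟩
      have : Nonempty (colouredSubshift L ν τ).carrier := ⟨z⟩
      refine ⟨S.image (Function.invFun f), Finset.card_image_le, fun x =>
        ⟨Function.invFun f (f x), Finset.mem_image_of_mem _ (hmem x.1 x.2 _), ?_⟩⟩
      exact (Function.invFun_eq ⟨x, rfl⟩).symm
    refine ⟨t, htcard, fun x _ => ?_⟩
    obtain ⟨y, hy, hxy⟩ := htimg x
    refine ⟨y, hy, mem_dynEntourage.2 fun k hk => hm _ _ fun c hc => ?_⟩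
    rw [iterate_shiftMap_apply, iterate_shiftMap_apply]
    have hc' := abs_le.1 hc
    have := congrFun (List.ofFn_injective hxy) ⟨(k + c + m).toNat, by omega⟩
    simp only at this
    rwa [show -(m : ℤ) + ((k + c + m).toNat : ℕ) = k + c by omega] at this
  obtain ⟨t, htS, ht⟩ := hcover
  have h1 : coverMincard (shiftMap L ν τ) univ U n ≤
      ((6 * L * ν ^ (2 * m + 1) * ν ^ n : ℕ) : ℕ∞) := by
    refine ht.coverMincard_le_card.trans ?_
    have : t.card ≤ 6 * L * ν ^ (2 * m + 1) * ν ^ n :=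
      htS.trans (hS.trans (by rw [pow_add]; exact (by ring : _ = _).le))
    exact_mod_cast this
  refine (ENat.toENNReal_mono h1).trans (le_of_eq ?_)
  push_cast
  ring

lemma le_topEntropy_shiftMap (hL : 1 ≤ L) :
    ENNReal.log (ν : ENNReal) ≤ topEntropy (shiftMap L ν τ) := by
  classical
  let U : Set ((colouredSubshift L ν τ).carrier × (colouredSubshift L ν τ).carrier) :=
    {p | p.1.1 0 = p.2.1 0}
  have hU : U ∈ 𝓤 (colouredSubshift L ν τ).carrier := by
    have hf : UniformContinuous fun x : (colouredSubshift L ν τ).carrier => x.1 (0 : ℤ) :=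
      (Pi.uniformContinuous_proj _ 0).comp uniformContinuous_subtype_val
    exact hf (mem_principal_self _ : SetRel.id ∈ 𝓤 (Letter L ν))
  refine le_trans ?_ (netEntropyEntourage_le_coverEntropy (shiftMap L ν τ) univ hU)
  rw [← expGrowthSup_pow]
  refine expGrowthSup_monotone fun n => ?_
  rcases n.eq_zero_or_pos with rfl | hn
  · rw [netMaxcard_zero _ ⟨⟨fun _ => 0, zero_mem_colouredSequences⟩, mem_univ _⟩]
    simp
  let j : Fin L := ⟨0, hL⟩
  -- the words of colour `j`, continued by their first letter, give `νⁿ` separated points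
  let f : (Fin n → colour ν j) → (colouredSubshift L ν τ).carrier := fun w =>
    ⟨fun c => if h : 0 ≤ c ∧ c < n then (w ⟨c.toNat, by omega⟩).1 else (w ⟨0, hn⟩).1, by
      refine mem_colouredSequences_of_forall_mem_colour (j := j) fun c => ?_
      split_ifs
      · exact (w _).2
      · exact (w _).2⟩
  have hfapp (w : Fin n → colour ν j) (i : Fin n) : (f w).1 (i : ℤ) = (w i).1 := by
    have : (0 : ℤ) ≤ i ∧ (i : ℤ) < n := by omega
    simp only [f, this, and_self, dite_true]
    congr 2
  have hfinj : Function.Injective f := by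
    intro v w h
    ext i
    rw [← hfapp v i, ← hfapp w i, h]
  have hnet : IsDynNetIn (shiftMap L ν τ) univ U n (Finset.univ.image f : Finset _) := by
    refine ⟨subset_univ _, ?_⟩
    simp only [Finset.coe_image, Finset.coe_univ, image_univ]
    rintro _ ⟨v, rfl⟩ _ ⟨w, rfl⟩ hvw
    rw [Function.onFun, Set.disjoint_left]
    intro z hzv hzw
    apply hvw
    congr 1
    ext i
    have h1 := mem_dynEntourage.1 hzv i i.2
    have h2 := mem_dynEntourage.1 hzw i i.2
    simp only [U, mem_ofPred_eq, iterate_shiftMap_apply, add_zero, hfapp] at h1 h2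
    rw [h1, h2]
  have hcard := hnet.card_le_netMaxcard
  rw [Finset.card_image_of_injective _ hfinj, Finset.card_univ, Fintype.card_fun, Fintype.card_fin,
    ← Nat.card_eq_fintype_card, Nat.card_coe_set_eq, ncard_colour] at hcard
  have := ENat.toENNReal_mono hcard
  simpa using this

theorem topEntropy_shiftMap (hL : 1 ≤ L) (hν : 2 ≤ ν) (hτ : Real.log 5 / Real.log ν ≤ τ) :
    topEntropy (shiftMap L ν τ) = ((Real.log ν : ℝ) : EReal) := by
  have h : ((Real.log ν : ℝ) : EReal) = ENNReal.log (ν : ENNReal) := by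
    rw [ENNReal.log_pos_real (by exact_mod_cast (by omega : ν ≠ 0)) (ENNReal.natCast_ne_top _)]
    simp
  rw [h]
  exact le_antisymm (topEntropy_shiftMap_le hL hν hτ) (le_topEntropy_shiftMap hL)

end TopologicalEntropy

/-! ### The Bernoulli measures on the subshift -/

section ColourBernoulli

variable {L ν : ℕ} {τ : ℝ}

lemma isProbabilityMeasure_uniformOn_colour (hν : 0 < ν) (j : Fin L) :
    IsProbabilityMeasure (uniformOn (colour ν j)) := by
  refine isProbabilityMeasure_uniformOn (Set.toFinite _) (Set.nonempty_of_ncard_ne_zero ?_)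
  rw [ncard_colour]
  omega

lemma measurableSet_carrier : MeasurableSet (colouredSubshift L ν τ).carrier := by
  have : OpensMeasurableSpace (Letter L ν) := ⟨le_top⟩
  exact (colouredSubshift L ν τ).isClosed.measurableSet

lemma fullBernoulli_compl_carrier (hν : 0 < ν) (j : Fin L) :
    fullBernoulli ν j (colouredSubshift L ν τ).carrierᶜ = 0 := by
  have := isProbabilityMeasure_uniformOn_colour hν j
  have h (n : ℤ) : ∀ᵐ x ∂fullBernoulli ν j, x n ∈ colour ν j := by
    have h1 := (measurePreserving_eval_infinitePi (fun _ : ℤ => uniformOn (colour ν j)) n)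
    have h2 : ∀ᵐ s ∂uniformOn (colour ν j), s ∈ colour ν j := by
      rw [ae_iff]
      exact (uniformOn_eq_zero_iff (Set.toFinite _)).2 (by ext; simp)
    exact h1.quasiMeasurePreserving.ae h2
  refine mem_ae_iff.1 ?_
  filter_upwards [ae_all_iff.2 h] with x hx
  exact mem_colouredSequences_of_forall_mem_colour hx

lemma measurePreserving_val (hν : 0 < ν) (j : Fin L) :
    MeasurePreserving Subtype.val (colourBernoulli ν τ j) (fullBernoulli ν j) := by
  refine ⟨measurable_subtype_coe, ?_⟩
  rw [colourBernoulli, map_comap_subtype_coe measurableSet_carrier]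
  exact Measure.restrict_eq_self_of_ae_mem (mem_ae_iff.2 (fullBernoulli_compl_carrier hν j))

open Classical in
/-- The equivariant retraction of the full shift onto the subshift that sends the complement of the
subshift to the fixed point `0`. -/
noncomputable def retraction (L ν : ℕ) (τ : ℝ) (x : ℤ → Letter L ν) :
    (colouredSubshift L ν τ).carrier :=
  ⟨if x ∈ (colouredSubshift L ν τ).carrier then x else fun _ => 0, by
    split_ifs with h
    · exact h
    · exact zero_mem_colouredSequences⟩

lemma retraction_val (x : (colouredSubshift L ν τ).carrier) : retraction L ν τ x.1 = x :=
  Subtype.ext (if_pos x.2)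

lemma measurePreserving_retraction (hν : 0 < ν) (j : Fin L) :
    MeasurePreserving (retraction L ν τ) (fullBernoulli ν j) (colourBernoulli ν τ j) := by
  have hm : Measurable (retraction L ν τ) :=
    (Measurable.ite measurableSet_carrier measurable_id measurable_const).subtype_mk
  refine ⟨hm, ?_⟩
  rw [← (measurePreserving_val hν j).map_eq, Measure.map_map hm measurable_subtype_coe]
  have : retraction L ν τ ∘ Subtype.val = id := funext retraction_val
  rw [this, Measure.map_id]

lemma semiconj_retraction :
    Function.Semiconj (retraction L ν τ) (shift (1 : ℤ)) (shiftMap L ν τ) := by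
  intro x
  by_cases hx : x ∈ (colouredSubshift L ν τ).carrier
  · exact (retraction_val (shiftMap L ν τ ⟨x, hx⟩)).trans
      (congrArg (shiftMap L ν τ) (retraction_val ⟨x, hx⟩).symm)
  · have hx' : shift (1 : ℤ) x ∉ (colouredSubshift L ν τ).carrier := by
      intro h
      apply hx
      have := (colouredSubshift L ν τ).mapsTo (-1) h
      rwa [← SymbolicDynamics.FullShift.shift_add, add_neg_cancel,
        SymbolicDynamics.FullShift.shift_zero] at this
    refine Subtype.ext ?_
    have h1 : (retraction L ν τ (shift (1 : ℤ) x)).1 = fun _ => 0 := if_neg hx'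
    have h2 : (retraction L ν τ x).1 = fun _ => 0 := if_neg hx
    have h3 : (shiftMap L ν τ (retraction L ν τ x)).1 = shift (1 : ℤ) (retraction L ν τ x).1 := rfl
    rw [h1, h3, h2]
    rfl

lemma ergodic_colourBernoulli (hν : 0 < ν) (j : Fin L) :
    Ergodic (shiftMap L ν τ) (colourBernoulli ν τ j) := by
  have := isProbabilityMeasure_uniformOn_colour hν j
  have herg : Ergodic (shift (1 : ℤ)) (fullBernoulli ν j) := ergodic_shift_infinitePi _
  have hr := measurePreserving_retraction (τ := τ) hν j
  have hsm : Measurable (shiftMap L ν τ) :=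
    ((measurable_shift 1).comp measurable_subtype_coe).subtype_mk
  refine ⟨⟨hsm, ?_⟩, hr.preErgodic_of_preErgodic_semiconj herg.toPreErgodic semiconj_retraction⟩
  conv_lhs => rw [← hr.map_eq]
  rw [Measure.map_map hsm hr.measurable, ← semiconj_retraction.comp_eq,
    ← Measure.map_map hr.measurable (measurable_shift 1), herg.map_eq, hr.map_eq]

lemma sum_negMulLog_uniformOn_colour (hν : 0 < ν) (j : Fin L) :
    ∑ s, Real.negMulLog ((uniformOn (colour ν j)).real {s}) = Real.log ν := by
  classical
  have hreal (s : Letter L ν) : (uniformOn (colour ν j)).real {s} =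
      if s ∈ colour ν j then (ν : ℝ)⁻¹ else 0 := by
    rw [measureReal_def, uniformOn, cond_apply (Set.toFinite _).measurableSet,
      Measure.count_apply_finite _ (Set.toFinite _), ← Set.ncard_eq_toFinset_card, ncard_colour]
    split_ifs with h
    · rw [inter_eq_right.2 (singleton_subset_iff.2 h), Measure.count_singleton]
      simp
    · rw [inter_singleton_eq_empty.2 h]
      simp
  have hcard : (Finset.univ.filter fun s => s ∈ colour ν j).card = ν := by
    rw [← Set.ncard_coe_finset]
    simpa using ncard_colour j
  have hν' : (ν : ℝ) ≠ 0 := by exact_mod_cast hν.ne'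
  simp only [hreal, apply_ite Real.negMulLog, Real.negMulLog_zero]
  rw [← Finset.sum_filter, Finset.sum_const, hcard, Real.negMulLog, Real.log_inv, nsmul_eq_mul]
  field_simp

/-- The subshift with `colourBernoulli` is a factor of the full shift by the retraction and an
extension of it by the inclusion, so that the two entropies agree. -/
lemma metricEntropy_colourBernoulli (hν : 0 < ν) (j : Fin L) :
    metricEntropy (shiftMap L ν τ) (colourBernoulli ν τ j) = ((Real.log ν : ℝ) : EReal) := by
  have := isProbabilityMeasure_uniformOn_colour hν j
  have hfull : metricEntropy (shift (1 : ℤ)) (fullBernoulli ν j) = ((Real.log ν : ℝ) : EReal) := by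
    rw [← sum_negMulLog_uniformOn_colour hν j]
    exact metricEntropy_shift_infinitePi _
  rw [← hfull]
  refine le_antisymm ?_ ?_
  · exact metricEntropy_le_of_semiconj (measurePreserving_retraction hν j)
      (ergodic_colourBernoulli hν j).measurable semiconj_retraction
  · exact metricEntropy_le_of_semiconj (measurePreserving_val hν j) (measurable_shift 1)
      fun _ => rfl

lemma isProbabilityMeasure_colourBernoulli (hν : 0 < ν) (j : Fin L) :
    IsProbabilityMeasure (colourBernoulli ν τ j) := by
  have := isProbabilityMeasure_uniformOn_colour hν j
  have : IsProbabilityMeasure (fullBernoulli ν j) := by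
    unfold fullBernoulli
    infer_instance
  rw [← (measurePreserving_retraction hν j).map_eq]
  exact Measure.isProbabilityMeasure_map (measurePreserving_retraction hν j).measurable.aemeasurable

lemma mutuallySingular_colourBernoulli (hν : 0 < ν) {i j : Fin L} (hij : i ≠ j) :
    Measure.MutuallySingular (colourBernoulli ν τ i) (colourBernoulli ν τ j) := by
  have hmp (k : Fin L) : MeasurePreserving (fun x : (colouredSubshift L ν τ).carrier => x.1 0)
      (colourBernoulli ν τ k) (uniformOn (colour ν k)) := by
    have := isProbabilityMeasure_uniformOn_colour hν k
    exact (measurePreserving_eval_infinitePi (fun _ : ℤ => uniformOn (colour ν k)) 0).comp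
      (measurePreserving_val hν k)
  refine ⟨(fun x => x.1 0) ⁻¹' colour ν j,
    (hmp j).measurable (Set.toFinite _).measurableSet, ?_, ?_⟩
  · rw [(hmp i).measure_preimage (Set.toFinite _).measurableSet.nullMeasurableSet,
      uniformOn_eq_zero_iff (Set.toFinite _)]
    exact (disjoint_colour hij).inter_eq
  · rw [← preimage_compl, (hmp j).measure_preimage
      (Set.toFinite _).measurableSet.nullMeasurableSet, uniformOn_eq_zero_iff (Set.toFinite _)]
    exact inter_compl_self _

end ColourBernoulli

theorem mainTheorem3 (L ν : ℕ) (τ : ℝ) (hL : 2 ≤ L) (hν : 2 ≤ ν)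
    (hτ : Real.log 5 / Real.log ν ≤ τ) :
    topEntropy (shiftMap L ν τ) = ((Real.log ν : ℝ) : EReal) ∧
    (∀ j : Fin L,
      IsMeasureOfMaximalEntropy (shiftMap L ν τ) (colourBernoulli ν τ j) ∧
      Ergodic (shiftMap L ν τ) (colourBernoulli ν τ j)) ∧
    Function.Injective (fun j : Fin L => colourBernoulli ν τ j) ∧
    (∀ i j : Fin L, i ≠ j →
      Measure.MutuallySingular (colourBernoulli ν τ i) (colourBernoulli ν τ j)) := by
  have hν0 : 0 < ν := by omega
  have htop := topEntropy_shiftMap (L := L) (by omega) hν hτ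
  refine ⟨htop, fun j => ⟨⟨isProbabilityMeasure_colourBernoulli hν0 j,
    (ergodic_colourBernoulli hν0 j).toMeasurePreserving,
    (metricEntropy_colourBernoulli hν0 j).trans htop.symm⟩, ergodic_colourBernoulli hν0 j⟩,
    fun i j hij => ?_, fun i j hij => mutuallySingular_colourBernoulli hν0 hij⟩
  by_contra hne
  have hsing := mutuallySingular_colourBernoulli (τ := τ) hν0 hne
  have hij' : colourBernoulli ν τ i = colourBernoulli ν τ j := hij
  rw [hij', Measure.MutuallySingular.self_iff] at hsing
  have := isProbabilityMeasure_colourBernoulli (τ := τ) hν0 j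
  exact IsProbabilityMeasure.ne_zero _ hsing
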